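/- Let $d_x,d_y,N$ be non-negative integers. For $\sigma:\mathbb{R}\to\mathbb{R}$ call $z_0\in\mathbb{R}$ a non-degenerating point of $\sigma$ if $\sigma$ is continuously differentiable at $z_0$ (differentiable in a neighbourhood of $z_0$ with $\sigma'$ continuous at $z_0$) and $\sigma'(z_0)\neq 0$; call $\sigma$ non-degenerate if it is continuous, is not a polynomial function, and has a non-degenerating point. A recurrent cell of width $d$ with activation $\sigma$ is a map $\mathcal{R}$ on sequences of length $N$ in $\mathbb{R}^{d}$ given by $$\mathcal{R}(x)[0]=\mathbf{0},\qquad \mathcal{R}(x)[t+1]=\sigma\bigl(A\,\mathcal{R}(x)[t]+B\,x[t+1]+\theta\bigr)\quad(0\le t<N),$$ where $A,B\in\mathbb{R}^{d\times d}$, $\theta\in\mathbb{R}^{d}$, and $\sigma$ acts componentwise. A deep RNN of width $d$ is a map $\mathcal{N}=\mathcal{Q}\circ\mathcal{R}_L\circ\cdots\circ\mathcal{R}_1\circ\mathcal{P}$ with $L\ge 2$, where $\mathcal{R}_1,\dots,\mathcal{R}_L$ are recurrent cells of width $d$ with activation $\sigma$ and $\mathcal{P}(x)[t]=Px[t]$,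 $\mathcal{Q}(s)[t]=Qs[t]$ for matrices $P\in\mathbb{R}^{d\times d_x}$, $Q\in\mathbb{R}^{d_y\times d}$. **Theorem.** Let $f:\mathbb{R}^{d_x\times N}\to\mathbb{R}^{d_y\times N}$ be continuous and past-dependent, i.e. for every $1\le t\le N$ the output token $f(x)[t]$ is a function of $(x[1],\dots,x[t])$ only, and let $\sigma$ be a non-degenerate activation function. Then for every $\epsilon>0$ and every compact $K\subset\mathbb{R}^{d_x}$ there is a deep RNN $\mathcal{N}$ with activation $\sigma$ and of width $d_x+d_y+3+\alpha(\sigma)$ such that $$\sup_{x\in K^N}\ \sup_{1\le t\le N}\bigl\|f(x)[t]-\mathcal{N}(x)[t]\bigr\|<\epsilon ,$$ where $\|\cdot\|$ is the Euclidean norm, $\alpha(\sigma)=0$ if $\sigma$ is the ReLU function $z\mapsto\max(z,0)$ or if $\sigma(z_0)=0$ for some non-degenerating point $z_0$ of $\sigma$, and $\alpha(\sigma)=1$ otherwise. -/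

import Mathlib

open scoped Topology Matrix

/-- `ReLU(z) = max(z, 0)`. -/
noncomputable def relu (z : ℝ) : ℝ := max z 0

/-- `z₀` is a non-degenerating point of `σ`: `σ` is continuously differentiable at `z₀` (that is,
differentiable in a neighbourhood of `z₀`, with `σ'` continuous at `z₀`) and `σ'(z₀) ≠ 0`. -/
def IsNondegeneratingPoint (σ : ℝ → ℝ) (z₀ : ℝ) : Prop :=
  (∀ᶠ z in 𝓝 z₀, DifferentiableAt ℝ σ z) ∧ ContinuousAt (deriv σ) z₀ ∧ deriv σ z₀ ≠ 0

/-- A non-degenerate activation function: continuous, not a polynomial function, and having a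
non-degenerating point. -/
def IsNondegenerate (σ : ℝ → ℝ) : Prop :=
  Continuous σ ∧ (¬ ∃ p : Polynomial ℝ, ∀ z, σ z = p.eval z) ∧
    ∃ z₀, IsNondegeneratingPoint σ z₀

open Classical in
/-- The additional width `α(σ)`: `0` if `σ` is ReLU or vanishes at some non-degenerating point,
and `1` otherwise. -/
noncomputable def additionalWidth (σ : ℝ → ℝ) : ℕ :=
  if σ = relu ∨ ∃ z₀, IsNondegeneratingPoint σ z₀ ∧ σ z₀ = 0 then 0 else 1

/-- A sequence-to-sequence map of length `N` is past-dependent if its output token at time `t` is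
a function of the input tokens up to (and including) time `t`. -/
def IsPastDependent {N : ℕ} {X Y : Type*} (f : (Fin N → X) → (Fin N → Y)) : Prop :=
  ∃ g : (t : Fin N) → ({s : Fin N // s ≤ t} → X) → Y, ∀ x t, f x t = g t (fun s => x s)

/-- The parameters of a recurrent cell of width `d`: weight matrices `A`, `B` and bias `θ`. -/
structure RNNCell (d : ℕ) where
  A : Matrix (Fin d) (Fin d) ℝ
  B : Matrix (Fin d) (Fin d) ℝ
  θ : Fin d → ℝ

/-- The state of the cell after `t` tokens of `x`: it is `0` at time `0`, and at time `t + 1` it is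
`σ (A (state at time t) + B x[t+1] + θ)` with `σ` applied to each component. The token `x[t+1]`
is `x ⟨t, _⟩`, as `Fin N` counts from `0`. -/
def RNNCell.state {d N : ℕ} (c : RNNCell d) (σ : ℝ → ℝ) (x : Fin N → Fin d → ℝ) :
    (t : ℕ) → t ≤ N → Fin d → ℝ
  | 0, _ => 0
  | t + 1, h => fun i =>
      σ ((c.A *ᵥ c.state σ x t (Nat.le_of_succ_le h) + c.B *ᵥ x ⟨t, h⟩ + c.θ) i)

/-- The sequence-to-sequence map of the cell; its first token is the state at time `1`. -/
def RNNCell.apply {d N : ℕ} (c : RNNCell d) (σ : ℝ → ℝ) (x : Fin N → Fin d → ℝ) :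
    Fin N → Fin d → ℝ :=
  fun t => c.state σ x (t + 1) t.isLt

/-- The parameters of a recurrent neural network of width `ds` from sequences in `ℝ^dx` to
sequences in `ℝ^dy`: a lifting matrix `P`, recurrent cells (the first cell to act is the head of
the list), and a projection matrix `Q`. -/
structure RNN (dx ds dy : ℕ) where
  P : Matrix (Fin ds) (Fin dx) ℝ
  cells : List (RNNCell ds)
  Q : Matrix (Fin dy) (Fin ds) ℝ

/-- A network is deep if it has at least two recurrent cells. -/
def RNN.IsDeep {dx ds dy : ℕ} (n : RNN dx ds dy) : Prop := 2 ≤ n.cells.length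

/-- The map `𝒬 ∘ ℛ_L ∘ ⋯ ∘ ℛ_1 ∘ 𝒫` on sequences of length `N`, with `𝒫` and `𝒬` acting on each
token. -/
def RNN.eval {dx ds dy N : ℕ} (n : RNN dx ds dy) (σ : ℝ → ℝ)
    (x : Fin N → EuclideanSpace ℝ (Fin dx)) : Fin N → EuclideanSpace ℝ (Fin dy) :=
  let s : Fin N → Fin ds → ℝ :=
    n.cells.foldl (fun s c => c.apply σ s) (fun t => n.P *ᵥ (x t).ofLp)
  fun t => WithLp.toLp 2 (n.Q *ᵥ s t)

open scoped ContDiff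

/-! Past-dependence makes `f` one continuous function on the compact space `Prefixes N K` of
nonempty prefixes of sequences in `K`. The proof approximates it by sums of `c * σ (windowSum W)`,
with the same windows `W` at every time, and then builds a network for such sums.

Density is `topologicalClosure_span_comp_eq_top`, an abstract form of the theorem that
non-polynomial activations are universal. Mollifying `σ` and differentiating `g (b + h * l)` in `h`
puts every power of an affine functional `l` in the closed span; hence also `exp l`. Exponentials
are closed under products, so Stone–Weierstrass applies.

For the network, suppose first that a component may be linear (`MixedCell`). A window sum is a
polynomial in the time shift with vector coefficients, so Horner's rule evaluates it with two scalar
components, one cell per coefficient. One further cell applies `σ` and another adds the result to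
the output (`flatMap_termCells_run`). This takes `dx + dy + 2` components.

Linear components are limits of `(σ (z₀ + δ * z) - σ z₀) / (δ * σ' z₀)` as `δ → 0`. A single extra
component carries `σ z₀` for all of them, and the next weight matrix absorbs the subtraction and
division (`MixedCell.exists_rnn_approx`). Thus width `dx + dy + 3` suffices for every `σ`, and the
additional width is only padding. -/

/-! ### Difference quotients with a moving base point. -/

/-- The difference quotient `(g (a + h * b) - g a) / h`, extended to `h = 0` by `b * g' a`, is
jointly continuous at points with `h = 0` around which `g` is continuously differentiable. -/
theorem continuousAt_diffQuotient {X : Type*} [TopologicalSpace X] {g : ℝ → ℝ} {h a b : X → ℝ}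
    {p : X} (hg : ContinuousAt (deriv g) (a p)) (hd : HasStrictDerivAt g (deriv g (a p)) (a p))
    (hh : ContinuousAt h p) (ha : ContinuousAt a p) (hb : ContinuousAt b p) (hp : h p = 0) :
    ContinuousAt (fun q => if h q = 0 then b q * deriv g (a q)
      else (g (a q + h q * b q) - g (a q)) / h q) p := by
  have hga : ContinuousAt (fun q => b q * deriv g (a q)) p := hb.mul (hg.comp_of_eq ha rfl)
  have hab : Filter.Tendsto (fun q => (a q + h q * b q, a q)) (𝓝 p) (𝓝 (a p, a p)) := by
    have : ContinuousAt (fun q => (a q + h q * b q, a q)) p := (ha.add (hh.mul hb)).prodMk ha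
    simpa [ContinuousAt, hp] using this
  -- Strict differentiability is what gives a first-order expansion while the base point `a q` moves
  -- too.
  have ho := hd.isLittleO.comp_tendsto hab
  simp only [Function.comp_def, add_sub_cancel_left, ContinuousLinearMap.toSpanSingleton_apply,
    smul_eq_mul] at ho
  have hlim : Filter.Tendsto (fun q => b q * deriv g (a p)) (𝓝 p) (𝓝 (b p * deriv g (a p))) :=
    hb.mul continuousAt_const
  rw [ContinuousAt, if_pos hp, Metric.tendsto_nhds]
  intro ε hε
  have hbb : ∀ᶠ q in 𝓝 p, |b q| < |b p| + 1 :=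
    hb.abs.eventually_lt continuousAt_const (by simp)
  have hc : 0 < ε / 2 / (|b p| + 1) := by positivity
  filter_upwards [ho.def hc, hbb, Metric.tendsto_nhds.1 hlim (ε / 2) (by positivity),
    Metric.tendsto_nhds.1 hga ε hε] with q h1 h2 h3 h4
  split_ifs with h0
  · exact h4
  · rw [Real.dist_eq] at h3 ⊢
    rw [Real.norm_eq_abs, Real.norm_eq_abs, abs_mul] at h1
    have h5 : |(g (a q + h q * b q) - g (a q)) / h q - b q * deriv g (a p)| ≤ ε / 2 := by
      have : (g (a q + h q * b q) - g (a q)) / h q - b q * deriv g (a p)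
          = (g (a q + h q * b q) - g (a q) - h q * b q * deriv g (a p)) / h q := by
        field_simp
      rw [this, abs_div, div_le_iff₀ (abs_pos.2 h0)]
      refine h1.trans ?_
      calc ε / 2 / (|b p| + 1) * (|h q| * |b q|)
          ≤ ε / 2 / (|b p| + 1) * (|h q| * (|b p| + 1)) := by gcongr
        _ = ε / 2 * |h q| := by field_simp
    calc _ ≤ |(g (a q + h q * b q) - g (a q)) / h q - b q * deriv g (a p)|
          + |b q * deriv g (a p) - b p * deriv g (a p)| := abs_sub_le _ _ _
      _ < ε := by linarith

theorem continuous_diffQuotient {X : Type*} [TopologicalSpace X] {g : ℝ → ℝ} {h a b : X → ℝ}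
    (hgc : Continuous g)
    (hg : ∀ p, h p = 0 → ContinuousAt (deriv g) (a p) ∧ HasStrictDerivAt g (deriv g (a p)) (a p))
    (hh : Continuous h) (ha : Continuous a) (hb : Continuous b) :
    Continuous (fun q => if h q = 0 then b q * deriv g (a q)
      else (g (a q + h q * b q) - g (a q)) / h q) := by
  rw [continuous_iff_continuousAt]
  intro p
  by_cases hp : h p = 0
  · exact continuousAt_diffQuotient (hg p hp).1 (hg p hp).2 hh.continuousAt ha.continuousAt
      hb.continuousAt hp
  · have : ContinuousAt (fun q => (g (a q + h q * b q) - g (a q)) / h q) p :=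
      ContinuousAt.div (by fun_prop) hh.continuousAt hp
    refine this.congr ?_
    filter_upwards [hh.continuousAt.eventually_ne hp] with q hq
    rw [if_neg hq]

/-! ### Polynomials of bounded degree. -/

theorem exists_polynomial_derivative_eq (p : Polynomial ℝ) :
    ∃ q : Polynomial ℝ, q.derivative = p ∧ q.natDegree ≤ p.natDegree + 1 := by
  refine ⟨p.sum fun n a => Polynomial.monomial (n + 1) (a / (n + 1)), ?_, ?_⟩
  · rw [Polynomial.sum, map_sum]
    conv_rhs => rw [p.as_sum_support]
    refine Finset.sum_congr rfl fun n _ => ?_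
    rw [Polynomial.derivative_monomial]
    simp only [Nat.add_sub_cancel, Nat.cast_add, Nat.cast_one]
    congr 1
    field_simp
  · refine Polynomial.natDegree_sum_le_of_forall_le _ _ fun n hn => ?_
    exact (Polynomial.natDegree_monomial_le _).trans
      (by have := Polynomial.le_natDegree_of_mem_supp n hn; omega)

theorem exists_polynomial_of_iteratedDeriv_eq_zero (k : ℕ) {g : ℝ → ℝ} (hg : ContDiff ℝ ∞ g)
    (h : ∀ x, iteratedDeriv k g x = 0) :
    ∃ p : Polynomial ℝ, p.natDegree ≤ k ∧ ∀ x, g x = p.eval x := by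
  induction k generalizing g with
  | zero => exact ⟨0, by simp, by simpa using h⟩
  | succ k ih =>
    obtain ⟨p, hpk, hp⟩ := ih (g := deriv g) (hg.iterate_deriv 1)
      (by simpa [iteratedDeriv_succ'] using h)
    obtain ⟨q, rfl, hq⟩ := exists_polynomial_derivative_eq p
    have hgd : Differentiable ℝ g := hg.differentiable (by simp)
    have hconst : ∀ x, g x - q.eval x = g 0 - q.eval 0 := fun x =>
      is_const_of_deriv_eq_zero (f := fun x => g x - q.eval x)
        (hgd.sub q.differentiable) (fun y => by
          have := ((hgd y).hasDerivAt.sub (q.hasDerivAt y)).deriv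
          simpa [hp, Pi.sub_def] using this) x 0
    refine ⟨q + Polynomial.C (g 0 - q.eval 0), ?_, fun x => ?_⟩
    · rw [Polynomial.natDegree_add_C]; omega
    · have := hconst x
      simp only [Polynomial.eval_add, Polynomial.eval_C]; linarith

/-- A pointwise limit of polynomial functions of bounded degree is a polynomial function. -/
theorem exists_polynomial_of_tendsto (k : ℕ) {g : ℕ → ℝ → ℝ} {f : ℝ → ℝ}
    (hg : ∀ n, ∃ p : Polynomial ℝ, p.natDegree ≤ k ∧ ∀ x, g n x = p.eval x)
    (h : ∀ x, Filter.Tendsto (fun n => g n x) Filter.atTop (𝓝 (f x))) :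
    ∃ p : Polynomial ℝ, ∀ x, f x = p.eval x := by
  -- Values at `k + 1` nodes determine a polynomial of degree at most `k`, and Lagrange
  -- interpolation depends continuously on them.
  let v : ℕ → ℝ := fun n => n
  have hv : Set.InjOn v (Finset.range (k + 1)) := fun a _ b _ hab => by simpa [v] using hab
  have key : ∀ n x, g n x
      = (Lagrange.interpolate (Finset.range (k + 1)) v fun i => g n (v i)).eval x := by
    intro n x
    obtain ⟨p, hpk, hp⟩ := hg n
    rw [hp, ← Lagrange.eq_interpolate_of_eval_eq (f := p) (fun i => g n (v i)) hv]
    · rw [Finset.card_range]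
      exact Polynomial.degree_le_natDegree.trans_lt (by exact_mod_cast Nat.lt_succ_of_le hpk)
    · intro i _; exact (hp _).symm
  refine ⟨Lagrange.interpolate (Finset.range (k + 1)) v fun i => f (v i), fun x => ?_⟩
  refine tendsto_nhds_unique (h x) ?_
  simp only [key _ x, Lagrange.interpolate_apply, Polynomial.eval_finsetSum, Polynomial.eval_mul,
    Polynomial.eval_C]
  exact tendsto_finsetSum _ fun i _ => (h _).mul_const _

/-! ### Density of the span of compositions with a non-polynomial function. -/

theorem integral_mem_of_isClosed {E : Type*} [NormedAddCommGroup E] [NormedSpace ℝ E]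
    [CompleteSpace E] {M : Submodule ℝ E} (hM : IsClosed (M : Set E)) {f : ℝ → E}
    (hf : Continuous f) (hfc : HasCompactSupport f) (hfM : ∀ s, f s ∈ M) : ∫ s, f s ∈ M := by
  have : CompleteSpace M := hM.completeSpace_coe
  let f' : ℝ → M := fun s => ⟨f s, hfM s⟩
  have hfi : MeasureTheory.Integrable f' :=
    (hf.subtype_mk hfM).integrable_of_hasCompactSupport
      (hfc.mono' fun s hs => subset_tsupport f fun h => hs (Subtype.ext h))
  have h := M.subtypeL.integral_comp_comm hfi
  exact (show ∫ s, f s = _ from h) ▸ (∫ s, f' s).2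

section UniversalApproximation

variable {Z : Type*} [TopologicalSpace Z]

/-- Each differentiation of `g (m + h * l)` in `h` produces one factor `l`. The difference quotients
lie in `M` by induction, and they converge in `C(Z, ℝ)` because they are jointly continuous in `h`
and the point. -/
theorem pow_mul_iteratedDeriv_mem {M : Submodule ℝ C(Z, ℝ)} (hM : IsClosed (M : Set C(Z, ℝ)))
    {V : Submodule ℝ C(Z, ℝ)} {g : ℝ → ℝ} (hg : ContDiff ℝ ∞ g)
    (hgM : ∀ l ∈ V, (⟨fun z => g (l z), hg.continuous.comp l.continuous⟩ : C(Z, ℝ)) ∈ M)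
    (k : ℕ) {l m : C(Z, ℝ)} (hl : l ∈ V) (hm : m ∈ V) (F : C(Z, ℝ))
    (hF : ∀ z, F z = l z ^ k * iteratedDeriv k g (m z)) : F ∈ M := by
  induction k generalizing m F with
  | zero =>
    convert! hgM m hm using 1
    ext z; simp [hF]
  | succ k ih =>
    have hcd : ∀ j : ℕ, ContDiff ℝ ∞ (iteratedDeriv j g) := fun j => by
      rw [iteratedDeriv_eq_iterate]; exact hg.iterate_deriv j
    set gk := iteratedDeriv k g with hgk
    have hgk1 : iteratedDeriv (k + 1) g = deriv gk := iteratedDeriv_succ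
    have hdc : Continuous (deriv gk) := hgk1 ▸ (hcd (k + 1)).continuous
    let q : ℝ × Z → ℝ := fun p => if p.1 = 0 then l p.2 * deriv gk (m p.2)
      else (gk (m p.2 + p.1 * l p.2) - gk (m p.2)) / p.1
    have hq : Continuous q := continuous_diffQuotient (h := fun p : ℝ × Z => p.1)
      (a := fun p => m p.2) (b := fun p => l p.2) (hcd k).continuous
      (fun p _ => ⟨hdc.continuousAt, ((hcd k).contDiffAt).hasStrictDerivAt (by simp)⟩)
      (by fun_prop) (by fun_prop) (by fun_prop)
    let Q : C(ℝ, C(Z, ℝ)) := ContinuousMap.curry ⟨fun p => l p.2 ^ k * q p, by fun_prop⟩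
    have hQ0 : Q 0 = F := by
      ext z; simp [Q, q, hF, hgk1]; ring
    have hcl : IsClosed (Q ⁻¹' M) := hM.preimage Q.continuous
    have hne : ∀ h : ℝ, h ≠ 0 → h ∈ Q ⁻¹' M := by
      intro h hh
      have h1 := ih (m := m + h • l) (V.add_mem hm (V.smul_mem h hl))
        ⟨fun z => l z ^ k * gk (m z + h * l z), by have := (hcd k).continuous; fun_prop⟩
        (by intro z; simp)
      have h2 := ih (m := m) hm
        ⟨fun z => l z ^ k * gk (m z), by have := (hcd k).continuous; fun_prop⟩
        (by intro z; simp)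
      have h3 := M.smul_mem h⁻¹ (M.sub_mem h1 h2)
      suffices hQ : Q h = _ from Set.mem_preimage.2 (hQ ▸ h3)
      ext z
      simp only [Q, q, ContinuousMap.curry_apply, ContinuousMap.coe_mk, if_neg hh,
        ContinuousMap.smul_apply, ContinuousMap.sub_apply, smul_eq_mul]
      field_simp
    -- A closed set containing all `h ≠ 0` contains `0`.
    have h0 : (0 : ℝ) ∈ Q ⁻¹' M := closure_minimal hne hcl (dense_compl_singleton (0 : ℝ) 0)
    rw [← hQ0]; exact h0

variable [CompactSpace Z]

-- The convolution is an integral of the translates `σ ∘ (l - s)`, which are admissible because `V`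
-- contains the constants.
open MeasureTheory Convolution in
theorem convolution_comp_mem {M : Submodule ℝ C(Z, ℝ)} (hM : IsClosed (M : Set C(Z, ℝ)))
    {V : Submodule ℝ C(Z, ℝ)} (hV : (1 : C(Z, ℝ)) ∈ V) (σ : C(ℝ, ℝ))
    (hσ : ∀ l ∈ V, σ.comp l ∈ M) {φ : ℝ → ℝ} (hφ : Continuous φ) (hφc : HasCompactSupport φ)
    {l : C(Z, ℝ)} (hl : l ∈ V) (F : C(Z, ℝ))
    (hF : ∀ z, F z = (φ ⋆[ContinuousLinearMap.lsmul ℝ ℝ, volume] σ) (l z)) : F ∈ M := by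
  let S : C(ℝ, C(Z, ℝ)) := ContinuousMap.curry ⟨fun p : ℝ × Z => σ (l p.2 - p.1), by fun_prop⟩
  have hS : ∀ s, S s ∈ M := fun s => by
    convert! hσ (l - s • 1) (V.sub_mem hl (V.smul_mem s hV)) using 1
    ext z; simp [S]
  have hf : Continuous fun s => φ s • S s := hφ.smul S.continuous
  have hfc : HasCompactSupport fun s => φ s • S s := hφc.smul_right
  have hco : F = ∫ s, φ s • S s := by
    ext z
    rw [ContinuousMap.integral_apply (hf.integrable_of_hasCompactSupport hfc), hF]
    rfl
  rw [hco]; exact integral_mem_of_isClosed hM hf hfc fun s => M.smul_mem _ (hS s)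

open MeasureTheory Convolution in
/-- Functions `σ ∘ l`, with `σ` continuous and not a polynomial and `l` in a point-separating
space of continuous functions that contains the constants, span a dense subspace. -/
theorem topologicalClosure_span_comp_eq_top (σ : C(ℝ, ℝ))
    (hσ : ¬ ∃ p : Polynomial ℝ, ∀ z, σ z = p.eval z)
    (V : Submodule ℝ C(Z, ℝ)) (hV : (1 : C(Z, ℝ)) ∈ V)
    (hsep : ∀ x y : Z, x ≠ y → ∃ l ∈ V, l x ≠ l y) :
    (Submodule.span ℝ {F : C(Z, ℝ) | ∃ l ∈ V, F = σ.comp l}).topologicalClosure = ⊤ := by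
  set M := (Submodule.span ℝ {F : C(Z, ℝ) | ∃ l ∈ V, F = σ.comp l}).topologicalClosure with hMdef
  have hM : IsClosed (M : Set C(Z, ℝ)) := Submodule.isClosed_topologicalClosure _
  have hσM : ∀ l ∈ V, σ.comp l ∈ M := fun l hl =>
    Submodule.le_topologicalClosure _ (Submodule.subset_span ⟨l, hl, rfl⟩)
  let φ : ℕ → ContDiffBump (0 : ℝ) := fun n => ⟨1 / (n + 2), 1 / (n + 1), by positivity, by
    gcongr; linarith⟩
  let g : ℕ → ℝ → ℝ := fun n => (φ n).normed volume ⋆[ContinuousLinearMap.lsmul ℝ ℝ, volume] σ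
  have hg : ∀ n, ContDiff ℝ ∞ (g n) := fun n =>
    (φ n).hasCompactSupport_normed.contDiff_convolution_left _ (φ n).contDiff_normed
      σ.continuous.locallyIntegrable
  have hgM : ∀ n, ∀ l ∈ V,
      (⟨fun z => g n (l z), (hg n).continuous.comp l.continuous⟩ : C(Z, ℝ)) ∈ M := fun n l hl =>
    convolution_comp_mem hM hV σ hσM (φ n).continuous_normed (φ n).hasCompactSupport_normed hl _
      fun z => rfl
  have hlim : ∀ x, Filter.Tendsto (fun n => g n x) Filter.atTop (𝓝 (σ x)) := fun x =>
    ContDiffBump.convolution_tendsto_right_of_continuous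
      tendsto_one_div_add_atTop_nhds_zero_nat σ.continuous x
  -- Otherwise every mollification is a polynomial of degree at most `k`, and so `σ`, their
  -- pointwise limit, is a polynomial.
  have hne : ∀ k, ∃ n b, iteratedDeriv k (g n) b ≠ 0 := by
    intro k
    by_contra! hk
    exact hσ (exists_polynomial_of_tendsto k
      (fun n => exists_polynomial_of_iteratedDeriv_eq_zero k (hg n) (hk n)) hlim)
  have hpow : ∀ l ∈ V, ∀ k : ℕ, l ^ k ∈ M := by
    intro l hl k
    obtain ⟨n, b, hb⟩ := hne k
    -- With the constant base point `b`, the derivative factor is a nonzero scalar.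
    have := pow_mul_iteratedDeriv_mem hM (hg n) (hgM n) k hl (V.smul_mem b hV)
      (iteratedDeriv k (g n) b • l ^ k) (fun z => by simp [mul_comm])
    have h2 := M.smul_mem (iteratedDeriv k (g n) b)⁻¹ this
    rwa [smul_smul, inv_mul_cancel₀ hb, one_smul] at h2
  have hexp : ∀ l ∈ V, NormedSpace.exp l ∈ M := by
    intro l hl
    refine hM.mem_of_tendsto (NormedSpace.exp_series_hasSum_exp' (𝕂 := ℝ) l)
      (Filter.Eventually.of_forall fun s => ?_)
    exact M.sum_mem fun k _ => M.smul_mem _ (hpow l hl k)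
  have hexp_apply : ∀ (l : C(Z, ℝ)) z, (NormedSpace.exp l : C(Z, ℝ)) z = Real.exp (l z) := by
    intro l z
    have h1 := (NormedSpace.exp_series_hasSum_exp' (𝕂 := ℝ) l).map
      (ContinuousMap.evalCLM ℝ z) (ContinuousMap.evalCLM ℝ z).continuous
    have h2 := NormedSpace.exp_series_hasSum_exp' (𝕂 := ℝ) (l z)
    rw [← Real.exp_eq_exp_ℝ] at h2
    refine h1.unique ?_
    convert! h2 using 1
  -- As `V` is closed under addition, its exponentials form a monoid, so the algebra they generate
  -- is just their span.
  let A₀ : Submonoid C(Z, ℝ) :=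
    { carrier := {F | ∃ l ∈ V, F = NormedSpace.exp l}
      one_mem' := ⟨0, V.zero_mem, by simp⟩
      mul_mem' := by
        rintro _ _ ⟨l, hl, rfl⟩ ⟨m, hm, rfl⟩
        exact ⟨l + m, V.add_mem hl hm, (NormedSpace.exp_add_of_commute (Commute.all _ _)).symm⟩ }
  let A : Subalgebra ℝ C(Z, ℝ) := Algebra.adjoin ℝ A₀
  have hA : Subalgebra.toSubmodule A ≤ M := by
    rw [Algebra.adjoin_eq_span, Submonoid.closure_eq, Submodule.span_le]
    rintro _ ⟨l, hl, rfl⟩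
    exact hexp l hl
  have hAsep : A.SeparatesPoints := by
    intro x y hxy
    obtain ⟨l, hl, hlxy⟩ := hsep x y hxy
    refine ⟨_, ⟨NormedSpace.exp l, Algebra.subset_adjoin ⟨l, hl, rfl⟩, rfl⟩, ?_⟩
    change (NormedSpace.exp l : C(Z, ℝ)) x ≠ (NormedSpace.exp l : C(Z, ℝ)) y
    rw [hexp_apply, hexp_apply]
    exact fun h => hlxy (Real.exp_injective h)
  have htop := ContinuousMap.subalgebra_topologicalClosure_eq_top_of_separatesPoints A hAsep
  rw [eq_top_iff]
  intro F _
  have hF : F ∈ A.topologicalClosure := htop ▸ trivial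
  exact closure_minimal (show (A : Set C(Z, ℝ)) ⊆ M from hA) hM hF

end UniversalApproximation

/-! ### Linear components as limits of neurons. -/

/-- By the tube lemma the estimate, trivial at `δ = 0`, persists on all of `K` for `δ` near `0`. A
nonzero `δ` is needed since the recurrent cells that realize mixed cells exist only then. -/
theorem exists_ne_zero_forall_norm_sub_lt {Y E : Type*} [TopologicalSpace Y]
    [SeminormedAddCommGroup E] {F : ℝ → Y → E} (hF : Continuous fun p : ℝ × Y => F p.1 p.2)
    {K : Set Y} (hK : IsCompact K) {ε : ℝ} (hε : 0 < ε) :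
    ∃ δ : ℝ, δ ≠ 0 ∧ ∀ x ∈ K, ‖F 0 x - F δ x‖ < ε := by
  have hU : IsOpen {p : ℝ × Y | ‖F 0 p.2 - F p.1 p.2‖ < ε} :=
    isOpen_lt ((hF.comp (continuous_const.prodMk continuous_snd)).sub hF).norm continuous_const
  obtain ⟨u, v, hu, -, h0u, hKv, huv⟩ := generalized_tube_lemma isCompact_singleton hK hU
    (s := {(0 : ℝ)}) (by rintro ⟨δ, x⟩ ⟨rfl, -⟩; simpa using hε)
  obtain ⟨δ, hδu, hδ⟩ :=
    (dense_compl_singleton (0 : ℝ)).inter_open_nonempty u hu ⟨0, h0u rfl⟩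
  exact ⟨δ, hδ, fun x hx => huv (Set.mk_mem_prod hδu (hKv hx))⟩

/-- A recurrent cell with components indexed by `ι` in which only the components marked in
`isNeuron` apply the activation function; the others are linear. -/
structure MixedCell (ι : Type*) where
  A : Matrix ι ι ℝ
  B : Matrix ι ι ℝ
  θ : ι → ℝ
  isNeuron : ι → Bool

section MixedCell

variable {ι : Type*} [Fintype ι]

/-- The states of a mixed cell on a sequence of tokens indexed by `1, 2, …`, where `act true` is
applied to the neurons and `act false` to the other components. -/
def MixedCell.state (act : Bool → ℝ → ℝ) (c : MixedCell ι) (X : ℕ → ι → ℝ) : ℕ → ι → ℝ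
  | 0 => 0
  | t + 1 => fun i => act (c.isNeuron i) ((c.A *ᵥ c.state act X t + c.B *ᵥ X (t + 1) + c.θ) i)

/-- The composition of a list of mixed cells, the head acting first. -/
def MixedCell.run (act : Bool → ℝ → ℝ) (l : List (MixedCell ι)) (X : ℕ → ι → ℝ) : ℕ → ι → ℝ :=
  l.foldl (fun X c => c.state act X) X

/-- The activation of a mixed cell: `σ` on neurons, and elsewhere the difference quotient of `σ`
at `z₀` with step `δ`, normalized to have slope `1`; the latter is the identity if `δ = 0`. -/
noncomputable def mixedAct (σ : ℝ → ℝ) (z₀ δ : ℝ) : Bool → ℝ → ℝ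
  | true, z => σ z
  | false, z =>
      (if δ = 0 then z * deriv σ z₀ else (σ (z₀ + δ * z) - σ z₀) / δ) / deriv σ z₀

theorem IsNondegeneratingPoint.hasStrictDerivAt {σ : ℝ → ℝ} {z₀ : ℝ}
    (h : IsNondegeneratingPoint σ z₀) : HasStrictDerivAt σ (deriv σ z₀) z₀ :=
  hasStrictDerivAt_of_hasDerivAt_of_continuousAt
    (h.1.mono fun _ hz => hz.hasDerivAt) h.2.1

theorem mixedAct_zero_false {σ : ℝ → ℝ} {z₀ : ℝ} (h : IsNondegeneratingPoint σ z₀) (z : ℝ) :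
    mixedAct σ z₀ 0 false z = z := by
  simp [mixedAct, h.2.2]

theorem continuous_mixedAct {σ : ℝ → ℝ} (hσ : Continuous σ) {z₀ : ℝ}
    (h : IsNondegeneratingPoint σ z₀) (b : Bool) :
    Continuous fun p : ℝ × ℝ => mixedAct σ z₀ p.1 b p.2 := by
  cases b with
  | true => exact hσ.comp continuous_snd
  | false =>
    exact (continuous_diffQuotient (h := fun p : ℝ × ℝ => p.1) (a := fun _ => z₀)
      (b := fun p => p.2) hσ (fun _ _ => ⟨h.2.1, h.hasStrictDerivAt⟩)
      continuous_fst continuous_const continuous_snd).div_const _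

theorem MixedCell.continuous_state {σ : ℝ → ℝ} (hσ : Continuous σ) {z₀ : ℝ}
    (h : IsNondegeneratingPoint σ z₀) (c : MixedCell ι) {Y : Type*} [TopologicalSpace Y]
    {δ : Y → ℝ} (hδ : Continuous δ) {X : Y → ℕ → ι → ℝ} (hX : Continuous X) :
    Continuous fun y => c.state (mixedAct σ z₀ (δ y)) (X y) := by
  refine continuous_pi fun t => ?_
  induction t with
  | zero => exact continuous_const
  | succ t ih =>
    refine continuous_pi fun i => ?_
    refine (continuous_mixedAct hσ h (c.isNeuron i)).comp (hδ.prodMk ?_)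
    have hXt : Continuous fun y => X y (t + 1) := (continuous_apply _).comp hX
    exact (continuous_apply i).comp
      (((continuous_const.matrix_mulVec ih).add (continuous_const.matrix_mulVec hXt)).add
        continuous_const)

theorem MixedCell.continuous_run {σ : ℝ → ℝ} (hσ : Continuous σ) {z₀ : ℝ}
    (h : IsNondegeneratingPoint σ z₀) (l : List (MixedCell ι)) {Y : Type*} [TopologicalSpace Y]
    {δ : Y → ℝ} (hδ : Continuous δ) {X : Y → ℕ → ι → ℝ} (hX : Continuous X) :
    Continuous fun y => MixedCell.run (mixedAct σ z₀ (δ y)) l (X y) := by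
  induction l generalizing X with
  | nil => exact hX
  | cons c l ih => exact ih (c.continuous_state hσ h hδ hX)

variable {d : ℕ}

/-- The matrix with rows `s i • M i`, placed in the positions `e (some i)`, and a zero row in the
position `e none`. -/
def liftRows {n : Type*} (e : Option ι ≃ Fin d) (s : ι → ℝ) (M : Matrix ι n ℝ) :
    Matrix (Fin d) n ℝ :=
  fun j => (e.symm j).elim 0 fun i => s i • M i

omit [Fintype ι] in
theorem liftRows_mulVec_some {n : Type*} [Fintype n] (e : Option ι ≃ Fin d) (s : ι → ℝ)
    (M : Matrix ι n ℝ) (v : n → ℝ) (i : ι) :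
    (liftRows e s M *ᵥ v) (e (some i)) = s i * (M *ᵥ v) i := by
  simp [Matrix.mulVec, dotProduct, liftRows, Finset.mul_sum, mul_assoc]

omit [Fintype ι] in
theorem liftRows_mulVec_none {n : Type*} [Fintype n] (e : Option ι ≃ Fin d) (s : ι → ℝ)
    (M : Matrix ι n ℝ) (v : n → ℝ) : (liftRows e s M *ᵥ v) (e none) = 0 := by
  simp [Matrix.mulVec, liftRows]

/-- The linear map recovering the state of a mixed cell from the state of the recurrent cell that
realizes it: neurons are stored as they are, and a linear component `z` is stored as `c + k * z`,
where `c` is the value of the component `e none`. -/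
noncomputable def decodeMatrix (e : Option ι ≃ Fin d) (k : ℝ) (isNeuron : ι → Bool) :
    Matrix ι (Fin d) ℝ :=
  fun i => if isNeuron i then Pi.single (e (some i)) 1
    else k⁻¹ • (Pi.single (e (some i)) 1 - Pi.single (e none) 1)

omit [Fintype ι] in
theorem decodeMatrix_mulVec (e : Option ι ≃ Fin d) (k : ℝ) (isNeuron : ι → Bool)
    (v : Fin d → ℝ) (i : ι) :
    (decodeMatrix e k isNeuron *ᵥ v) i = if isNeuron i then v (e (some i))
      else (v (e (some i)) - v (e none)) / k := by
  simp only [Matrix.mulVec, decodeMatrix]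
  split_ifs
  · simp
  · rw [smul_dotProduct, sub_dotProduct, single_one_dotProduct, single_one_dotProduct,
      smul_eq_mul, div_eq_inv_mul]

/-- The recurrent cell that realizes a mixed cell, given the matrix `D` that decodes its input. -/
noncomputable def MixedCell.realize (c : MixedCell ι) (e : Option ι ≃ Fin d) (z₀ δ k : ℝ)
    (D : Matrix ι (Fin d) ℝ) : RNNCell d where
  A := liftRows e (fun i => if c.isNeuron i then 1 else δ) (c.A * decodeMatrix e k c.isNeuron)
  B := liftRows e (fun i => if c.isNeuron i then 1 else δ) (c.B * D)
  θ := fun j => (e.symm j).elim z₀ fun i => if c.isNeuron i then c.θ i else δ * c.θ i + z₀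

/-- The component `e none` receives only the bias `z₀`, so it equals `σ z₀` from time `1` on, while
a linear component stores `σ (z₀ + δ * z)`. -/
theorem MixedCell.decode_realize_state (c : MixedCell ι) (e : Option ι ≃ Fin d) (σ : ℝ → ℝ)
    (z₀ : ℝ) {δ : ℝ} (hδ : δ ≠ 0) (D : Matrix ι (Fin d) ℝ) {N : ℕ} (s : Fin N → Fin d → ℝ)
    (X : ℕ → ι → ℝ) (h : ∀ t : Fin N, D *ᵥ s t = X (t + 1)) (t : ℕ) (ht : t ≤ N) :
    decodeMatrix e (δ * deriv σ z₀) c.isNeuron *ᵥ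
      (c.realize e z₀ δ (δ * deriv σ z₀) D).state σ s t ht
      = c.state (mixedAct σ z₀ δ) X t := by
  induction t with
  -- At time `0` the reference component is `0` as well. Subtracting it, rather than the constant `σ
  -- z₀`, makes the decoding exact here too.
  | zero => simp [RNNCell.state, MixedCell.state]
  | succ t ih =>
    ext i
    rw [decodeMatrix_mulVec]
    have hX : D *ᵥ s ⟨t, ht⟩ = X (t + 1) := h ⟨t, ht⟩
    simp only [RNNCell.state, MixedCell.state, MixedCell.realize, Pi.add_apply,
      liftRows_mulVec_some, liftRows_mulVec_none, Equiv.symm_apply_apply, Option.elim_some,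
      Option.elim_none, zero_add]
    simp only [← Matrix.mulVec_mulVec, hX]
    have ih' := ih (Nat.le_of_succ_le ht)
    simp only [MixedCell.realize] at ih'
    rw [ih']
    cases hn : c.isNeuron i with
    | true => simp [mixedAct]
    | false =>
      simp only [mixedAct, if_neg hδ, Bool.false_eq_true, if_false, div_div]
      congr 3
      ring

theorem MixedCell.exists_realize_run (e : Option ι ≃ Fin d) (σ : ℝ → ℝ) (z₀ : ℝ) {δ : ℝ}
    (hδ : δ ≠ 0) (N : ℕ) (l : List (MixedCell ι)) (D : Matrix ι (Fin d) ℝ) :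
    ∃ (cs : List (RNNCell d)) (D' : Matrix ι (Fin d) ℝ), cs.length = l.length ∧
      ∀ (s : Fin N → Fin d → ℝ) (X : ℕ → ι → ℝ), (∀ t : Fin N, D *ᵥ s t = X (t + 1)) →
        ∀ t : Fin N, D' *ᵥ cs.foldl (fun s c => c.apply σ s) s t
          = MixedCell.run (mixedAct σ z₀ δ) l X (t + 1) := by
  induction l generalizing D with
  | nil => exact ⟨[], D, rfl, fun s X h t => h t⟩
  | cons c l ih =>
    obtain ⟨cs, D', hlen, hcs⟩ := ih (decodeMatrix e (δ * deriv σ z₀) c.isNeuron)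
    refine ⟨c.realize e z₀ δ (δ * deriv σ z₀) D :: cs, D', by simp [hlen], fun s X h t => ?_⟩
    exact hcs _ _ (fun t => c.decode_realize_state e σ z₀ hδ D s X h (t + 1) t.isLt) t

theorem MixedCell.exists_rnn_eval_eq {dx dy : ℕ} (e : Option ι ≃ Fin d) (σ : ℝ → ℝ) (z₀ : ℝ)
    {δ : ℝ} (hδ : δ ≠ 0) (N : ℕ) (l : List (MixedCell ι)) (P : Matrix ι (Fin dx) ℝ)
    (Q : Matrix (Fin dy) ι ℝ) :
    ∃ n : RNN dx d dy, n.cells.length = l.length ∧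
      ∀ (x : Fin N → EuclideanSpace ℝ (Fin dx)) (X : ℕ → ι → ℝ),
        (∀ t : Fin N, P *ᵥ (x t).ofLp = X (t + 1)) → ∀ t : Fin N,
          n.eval σ x t = WithLp.toLp 2 (Q *ᵥ MixedCell.run (mixedAct σ z₀ δ) l X (t + 1)) := by
  obtain ⟨cs, D, hlen, hcs⟩ :=
    -- The lifted input has passed through no activation, so its coordinates are read off unchanged.
    exists_realize_run e σ z₀ hδ N l (decodeMatrix e 1 fun _ => true)
  refine ⟨⟨liftRows e 1 P, cs, Q * D⟩, hlen, fun x X h t => ?_⟩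
  simp only [RNN.eval]
  rw [← Matrix.mulVec_mulVec, hcs _ X]
  intro t
  ext i
  simp [decodeMatrix_mulVec, liftRows_mulVec_some, ← h]

/-- On a compact set, a network of mixed cells is a uniform limit of recurrent networks with one
more component. -/
theorem MixedCell.exists_rnn_approx {dx dy : ℕ} (e : Option ι ≃ Fin d) {σ : ℝ → ℝ}
    (hσ : Continuous σ) {z₀ : ℝ} (hz₀ : IsNondegeneratingPoint σ z₀) (N : ℕ)
    (l : List (MixedCell ι)) (P : Matrix ι (Fin dx) ℝ) (Q : Matrix (Fin dy) ι ℝ)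
    {X : (Fin N → EuclideanSpace ℝ (Fin dx)) → ℕ → ι → ℝ} (hX : Continuous X)
    (hPX : ∀ x (t : Fin N), P *ᵥ (x t).ofLp = X x (t + 1))
    {K : Set (Fin N → EuclideanSpace ℝ (Fin dx))} (hK : IsCompact K) {ε : ℝ} (hε : 0 < ε) :
    ∃ n : RNN dx d dy, n.cells.length = l.length ∧ ∀ x ∈ K, ∀ t : Fin N,
      ‖WithLp.toLp 2 (Q *ᵥ MixedCell.run (mixedAct σ z₀ 0) l (X x) (t + 1)) - n.eval σ x t‖
        < ε := by
  let F : ℝ → (Fin N → EuclideanSpace ℝ (Fin dx)) → Fin N → EuclideanSpace ℝ (Fin dy) :=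
    fun δ x t => WithLp.toLp 2 (Q *ᵥ MixedCell.run (mixedAct σ z₀ δ) l (X x) (t + 1))
  have hF : Continuous fun p : ℝ × (Fin N → EuclideanSpace ℝ (Fin dx)) => F p.1 p.2 := by
    refine continuous_pi fun t => (PiLp.continuous_toLp 2 _).comp ?_
    have := MixedCell.continuous_run hσ hz₀ l
      (continuous_fst (X := ℝ) (Y := Fin N → EuclideanSpace ℝ (Fin dx)))
      (hX.comp continuous_snd)
    exact continuous_const.matrix_mulVec ((continuous_apply _).comp this)
  obtain ⟨δ, hδ, hδF⟩ := exists_ne_zero_forall_norm_sub_lt hF hK hε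
  obtain ⟨n, hn, hneval⟩ := exists_rnn_eval_eq e σ z₀ hδ N l P Q
  refine ⟨n, hn, fun x hx t => ?_⟩
  rw [hneval x (X x) (hPX x)]
  exact (norm_le_pi_norm (F 0 x - F δ x) t).trans_lt (hδF x hx)

end MixedCell

/-! ### Window sums by Horner's rule. -/

/-- The affine functional with window `W` of the tokens `X 1, …, X t`. -/
def windowSum {n : ℕ} (W : ℕ → (Fin n → ℝ) × ℝ) (X : ℕ → Fin n → ℝ) (t : ℕ) : ℝ :=
  ∑ j ∈ Finset.range t, ((W j).1 ⬝ᵥ X (t - j) + (W j).2)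

theorem windowSum_succ {n : ℕ} (W : ℕ → (Fin n → ℝ) × ℝ) (X : ℕ → Fin n → ℝ) (t : ℕ) :
    windowSum W X (t + 1)
      = (W 0).1 ⬝ᵥ X (t + 1) + (W 0).2 + windowSum (fun j => W (j + 1)) X t := by
  simp [windowSum, Finset.sum_range_succ' _ t, add_comm]

/-- The components of the networks below: the current token, the accumulated output, two
components `inr (inl false)` and `inr (inl true)` for the computation, and unused ones. -/
abbrev Component (dx dy a : ℕ) : Type := (Fin dx ⊕ Fin dy) ⊕ (Bool ⊕ Fin a)

section Component

variable {dx dy a : ℕ}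

/-- One step of Horner's rule in the shift operator. -/
def hornerCell (w : (Fin dx → ℝ) × ℝ) : MixedCell (Component dx dy a) where
  A
    -- The only recurrent connection: it delays the first computation component by one time step.
    | .inr (.inl true) => Pi.single (.inr (.inl false)) 1
    | _ => 0
  B
    | .inl k => Pi.single (.inl k) 1
    | .inr (.inl false) => Sum.elim (Sum.elim w.1 0) (Pi.single (.inl true) 1)
    | _ => 0
  θ := Pi.single (.inr (.inl false)) w.2
  isNeuron _ := false

/-- The cell that applies the activation function to the first computation component. -/
def neuronCell : MixedCell (Component dx dy a) where
  A := 0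
  B
    | .inl k => Pi.single (.inl k) 1
    | .inr (.inl false) => Pi.single (.inr (.inl false)) 1
    | _ => 0
  θ := 0
  isNeuron i := i = .inr (.inl false)

/-- The cell that adds `c` times the first computation component to the output. -/
def accumulateCell (c : Fin dy → ℝ) : MixedCell (Component dx dy a) where
  A := 0
  B
    | .inl (.inl k) => Pi.single (.inl (.inl k)) 1
    | .inl (.inr k) => Pi.single (.inl (.inr k)) 1 + c k • Pi.single (.inr (.inl false)) 1
    | _ => 0
  θ := 0
  isNeuron _ := false

/-- Cells that compute a window sum. -/
def hornerCells : ℕ → (ℕ → (Fin dx → ℝ) × ℝ) → List (MixedCell (Component dx dy a))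
  | 0, _ => []
  | n + 1, W => hornerCells n (fun j => W (j + 1)) ++ [hornerCell (W 0)]

/-- Cells that add `c * σ (windowSum W)` to the output. -/
def termCells (N : ℕ) (W : ℕ → (Fin dx → ℝ) × ℝ) (c : Fin dy → ℝ) :
    List (MixedCell (Component dx dy a)) :=
  hornerCells (N + 1) W ++ [neuronCell, accumulateCell c]

/-- The tokens carried by a sequence of states. -/
def tokens (S : ℕ → Component dx dy a → ℝ) : ℕ → Fin dx → ℝ := fun t k => S t (.inl (.inl k))

theorem MixedCell.run_append {ι : Type*} [Fintype ι] (act : Bool → ℝ → ℝ)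
    (l l' : List (MixedCell ι)) (X : ℕ → ι → ℝ) :
    MixedCell.run act (l ++ l') X = MixedCell.run act l' (MixedCell.run act l X) := by
  simp [MixedCell.run]

variable {act : Bool → ℝ → ℝ} (hact : ∀ z, act false z = z)

include hact

theorem hornerCell_state_inl (w : (Fin dx → ℝ) × ℝ) {S : ℕ → Component dx dy a → ℝ}
    (hS : S 0 = 0) (t : ℕ) (k : Fin dx ⊕ Fin dy) :
    (hornerCell w).state act S t (.inl k) = S t (.inl k) := by
  cases t with
  | zero => simp [MixedCell.state, hS]
  | succ t =>
    simp [MixedCell.state, hornerCell, hact, Matrix.mulVec]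

theorem hornerCell_state_false (w : (Fin dx → ℝ) × ℝ) (S : ℕ → Component dx dy a → ℝ) (t : ℕ) :
    (hornerCell w).state act S (t + 1) (.inr (.inl false))
      = w.1 ⬝ᵥ tokens S (t + 1) + w.2 + S (t + 1) (.inr (.inl true)) := by
  simp [MixedCell.state, hornerCell, hact, Matrix.mulVec, dotProduct, tokens, Fintype.sum_sum_type,
    Pi.single_apply]
  ring

theorem hornerCell_state_true (w : (Fin dx → ℝ) × ℝ) (S : ℕ → Component dx dy a → ℝ) (t : ℕ) :
    (hornerCell w).state act S (t + 1) (.inr (.inl true))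
      = (hornerCell w).state act S t (.inr (.inl false)) := by
  conv_lhs => rw [MixedCell.state]
  simp [hornerCell, hact, Matrix.mulVec]

theorem accumulateCell_state_token (c : Fin dy → ℝ) (S : ℕ → Component dx dy a → ℝ) (t : ℕ)
    (k : Fin dx) :
    (accumulateCell c).state act S (t + 1) (.inl (.inl k)) = S (t + 1) (.inl (.inl k)) := by
  simp [MixedCell.state, accumulateCell, hact, Matrix.mulVec]

theorem accumulateCell_state_output (c : Fin dy → ℝ) (S : ℕ → Component dx dy a → ℝ) (t : ℕ)
    (k : Fin dy) :
    (accumulateCell c).state act S (t + 1) (.inl (.inr k))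
      = S (t + 1) (.inl (.inr k)) + c k * S (t + 1) (.inr (.inl false)) := by
  simp [MixedCell.state, accumulateCell, hact, Matrix.mulVec, dotProduct, add_mul,
    Finset.sum_add_distrib, Pi.single_apply]

theorem accumulateCell_state_inr (c : Fin dy → ℝ) (S : ℕ → Component dx dy a → ℝ) (t : ℕ)
    (k : Bool ⊕ Fin a) : (accumulateCell c).state act S t (.inr k) = 0 := by
  cases t <;> simp [MixedCell.state, accumulateCell, hact, Matrix.mulVec]

theorem neuronCell_state_inl (S : ℕ → Component dx dy a → ℝ) (t : ℕ) (k : Fin dx ⊕ Fin dy) :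
    neuronCell.state act S (t + 1) (.inl k) = S (t + 1) (.inl k) := by
  simp [MixedCell.state, neuronCell, hact, Matrix.mulVec]

omit hact in
theorem neuronCell_state_false (S : ℕ → Component dx dy a → ℝ) (t : ℕ) :
    neuronCell.state act S (t + 1) (.inr (.inl false))
      = act true (S (t + 1) (.inr (.inl false))) := by
  simp [MixedCell.state, neuronCell, Matrix.mulVec]

/-- Induction on `windowSum_succ`: each cell adds its coefficient to the delayed partial sum passed
on by the previous cell. Only `n` coefficients enter, whence `t ≤ n`. The zero initial state cuts
the window off at the first token, biases included. -/
theorem hornerCells_run (n : ℕ) (W : ℕ → (Fin dx → ℝ) × ℝ) {S : ℕ → Component dx dy a → ℝ}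
    (hS : S 0 = 0) (hv : ∀ t, S t (.inr (.inl true)) = 0) :
    MixedCell.run act (hornerCells n W) S 0 = 0 ∧
      (∀ t k, MixedCell.run act (hornerCells n W) S t (.inl k) = S t (.inl k)) ∧
      (∀ t ≤ n, MixedCell.run act (hornerCells n W) S (t + 1) (.inr (.inl true))
        = windowSum W (tokens S) t) ∧
      (n ≠ 0 → ∀ t ≤ n, MixedCell.run act (hornerCells n W) S t (.inr (.inl false))
        = windowSum W (tokens S) t) := by
  induction n generalizing W with
  | zero =>
    refine ⟨hS, fun t k => rfl, fun t ht => ?_, fun h => absurd rfl h⟩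
    obtain rfl : t = 0 := by omega
    exact (hv 1).trans (by simp [windowSum])
  | succ n ih =>
    obtain ⟨h0, hinl, htrue, -⟩ := ih fun j => W (j + 1)
    rw [hornerCells, MixedCell.run_append]
    set R := MixedCell.run act (hornerCells n fun j => W (j + 1)) S with hR
    have hrun : MixedCell.run act [hornerCell (W 0)] R = (hornerCell (W 0)).state act R := rfl
    rw [hrun]
    have htok : tokens R = tokens S := by
      ext t k; exact hinl t (.inl k)
    have hfalse : ∀ t ≤ n + 1, (hornerCell (W 0)).state act R t (.inr (.inl false))
        = windowSum W (tokens S) t := by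
      intro t ht
      cases t with
      | zero => simp [MixedCell.state, windowSum]
      | succ t =>
        rw [hornerCell_state_false hact, htrue t (by omega), windowSum_succ, htok]
    refine ⟨rfl, fun t k => ?_, fun t ht => ?_, fun _ => hfalse⟩
    · rw [hornerCell_state_inl hact _ h0, hinl]
    · rw [hornerCell_state_true hact, hfalse t ht]

/-- The hypotheses `hS` and `hv` reappear as conclusions, because the accumulating cell clears the
computation components; so terms can be chained. -/
theorem termCells_run (N : ℕ) (W : ℕ → (Fin dx → ℝ) × ℝ) (c : Fin dy → ℝ)
    {S : ℕ → Component dx dy a → ℝ} (hS : S 0 = 0) (hv : ∀ t, S t (.inr (.inl true)) = 0) :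
    MixedCell.run act (termCells N W c) S 0 = 0 ∧
      (∀ t, MixedCell.run act (termCells N W c) S t (.inr (.inl true)) = 0) ∧
      tokens (MixedCell.run act (termCells N W c) S) = tokens S ∧
      ∀ t < N, ∀ k, MixedCell.run act (termCells N W c) S (t + 1) (.inl (.inr k))
        = S (t + 1) (.inl (.inr k)) + c k * act true (windowSum W (tokens S) (t + 1)) := by
  obtain ⟨-, hinl, -, hfalse⟩ := hornerCells_run hact (N + 1) W hS hv
  rw [termCells, MixedCell.run_append]
  set R := MixedCell.run act (hornerCells (N + 1) W) S with hR
  have hrun : MixedCell.run act [neuronCell, accumulateCell c] R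
    = (accumulateCell c).state act (neuronCell.state act R) := rfl
  rw [hrun]
  refine ⟨rfl, fun t => accumulateCell_state_inr hact _ _ _ _, ?_, fun t ht k => ?_⟩
  · ext t k
    cases t with
    | zero => simp [tokens, MixedCell.state, hS]
    | succ t =>
      rw [tokens, accumulateCell_state_token hact, neuronCell_state_inl hact, hinl]
      rfl
  · rw [accumulateCell_state_output hact, neuronCell_state_inl hact, neuronCell_state_false, hinl,
      hfalse (by omega) _ (by omega)]

/-- Cells computing a sum of terms `c * σ (windowSum W)` over a list of pairs `(W, c)`. -/
theorem flatMap_termCells_run (N : ℕ) (l : List ((ℕ → (Fin dx → ℝ) × ℝ) × (Fin dy → ℝ)))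
    {S : ℕ → Component dx dy a → ℝ} (hS : S 0 = 0) (hv : ∀ t, S t (.inr (.inl true)) = 0)
    (t : ℕ) (ht : t < N) (k : Fin dy) :
    MixedCell.run act (l.flatMap fun p => termCells N p.1 p.2) S (t + 1) (.inl (.inr k))
      = S (t + 1) (.inl (.inr k))
        + (l.map fun p => p.2 k * act true (windowSum p.1 (tokens S) (t + 1))).sum := by
  induction l generalizing S with
  | nil => simp [MixedCell.run]
  | cons p l ih =>
    obtain ⟨h0, hv', htok, hout⟩ := termCells_run hact N p.1 p.2 hS hv
    rw [List.flatMap_cons, MixedCell.run_append, ih h0 hv', htok, hout t ht, List.map_cons,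
      List.sum_cons, add_assoc]

end Component

/-! ### Approximation on the compact space of prefixes. -/

/-- The tokens of `x` as a sequence indexed by `1, …, N`, padded by zeros. -/
def padTokens {n N : ℕ} (x : Fin N → EuclideanSpace ℝ (Fin n)) : ℕ → Fin n → ℝ
  | 0 => 0
  | s + 1 => if h : s < N then (x ⟨s, h⟩).ofLp else 0

theorem padTokens_succ {n N : ℕ} (x : Fin N → EuclideanSpace ℝ (Fin n)) (t : Fin N) :
    padTokens x (t + 1) = (x t).ofLp := by
  simp [padTokens]

theorem continuous_padTokens {n N : ℕ} :
    Continuous (padTokens : (Fin N → EuclideanSpace ℝ (Fin n)) → ℕ → Fin n → ℝ) := by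
  refine continuous_pi fun s => ?_
  cases s with
  | zero => exact continuous_const
  | succ s =>
    by_cases h : s < N
    · simp only [padTokens, h, dif_pos]
      exact (PiLp.continuous_ofLp 2 _).comp (continuous_apply _)
    · simp only [padTokens, h, dif_neg, not_false_eq_true]
      exact continuous_const

theorem continuous_windowSum {n : ℕ} (W : ℕ → (Fin n → ℝ) × ℝ) (t : ℕ) :
    Continuous fun X : ℕ → Fin n → ℝ => windowSum W X t :=
  continuous_finsetSum _ fun _ _ =>
    (continuous_const.dotProduct (continuous_apply _)).add continuous_const

theorem windowSum_congr {n : ℕ} (W : ℕ → (Fin n → ℝ) × ℝ) {X X' : ℕ → Fin n → ℝ} {t : ℕ}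
    (h : ∀ s, 0 < s → s ≤ t → X s = X' s) : windowSum W X t = windowSum W X' t :=
  Finset.sum_congr rfl fun j hj => by
    rw [h (t - j) (by have := Finset.mem_range.1 hj; omega) (Nat.sub_le _ _)]

/-- The sequences of tokens in `K` of length between `1` and `N`, as pairs of the index of the
last token and the tokens. -/
abbrev Prefixes {n : ℕ} (N : ℕ) (K : Set (EuclideanSpace ℝ (Fin n))) : Type :=
  Σ t : Fin N, ({s : Fin N // s ≤ t} → K)

section Prefixes

variable {n N : ℕ} {K : Set (EuclideanSpace ℝ (Fin n))}

/-- The extension of a partial sequence by zeros. -/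
noncomputable def Prefixes.extend (z : Prefixes N K) : Fin N → EuclideanSpace ℝ (Fin n) :=
  fun s => if h : s ≤ z.1 then z.2 ⟨s, h⟩ else 0

theorem Prefixes.continuous_extend :
    Continuous (Prefixes.extend : Prefixes N K → Fin N → EuclideanSpace ℝ (Fin n)) := by
  refine continuous_sigma fun t => continuous_pi fun s => ?_
  by_cases h : s ≤ t
  · simp only [Prefixes.extend, h, dif_pos]
    exact continuous_subtype_val.comp
      (continuous_apply (A := fun _ : {s : Fin N // s ≤ t} => K) ⟨s, h⟩)
  · simp only [Prefixes.extend, h, dif_neg, not_false_eq_true]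
    exact continuous_const

theorem Prefixes.continuous_of_fst {Y : Type*} [TopologicalSpace Y]
    {F : Fin N → (Fin N → EuclideanSpace ℝ (Fin n)) → Y} (hF : ∀ t, Continuous (F t)) :
    Continuous fun z : Prefixes N K => F z.1 z.extend :=
  continuous_sigma fun t => (hF t).comp (continuous_extend.comp continuous_sigmaMk)

/-- Window sums as functions of the partial sequence. -/
noncomputable def windowFunctional :
    (ℕ → (Fin n → ℝ) × ℝ) →ₗ[ℝ] C(Prefixes N K, ℝ) where
  toFun W := ⟨fun z => windowSum W (padTokens z.extend) (z.1 + 1),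
    Prefixes.continuous_of_fst fun t => (continuous_windowSum W (t + 1)).comp continuous_padTokens⟩
  map_add' W W' := by
    ext z
    simp only [windowSum, ContinuousMap.coe_mk, ContinuousMap.add_apply, Pi.add_apply,
      Prod.fst_add, Prod.snd_add, add_dotProduct, ← Finset.sum_add_distrib]
    exact Finset.sum_congr rfl fun _ _ => by ring
  map_smul' c W := by
    ext z
    simp only [windowSum, ContinuousMap.coe_mk, ContinuousMap.smul_apply, Pi.smul_apply,
      Prod.smul_fst, Prod.smul_snd, smul_dotProduct, Finset.smul_sum, smul_add, RingHom.id_apply]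

theorem windowFunctional_apply (W : ℕ → (Fin n → ℝ) × ℝ) (z : Prefixes N K) :
    windowFunctional W z = windowSum W (padTokens z.extend) (z.1 + 1) := rfl

theorem one_mem_range_windowFunctional :
    (1 : C(Prefixes N K, ℝ)) ∈ LinearMap.range (windowFunctional (N := N) (K := K)) := by
  -- Slot `0`, the current token, lies in every window, so its bias is counted exactly once.
  refine ⟨fun j => if j = 0 then (0, 1) else 0, ?_⟩
  ext z
  rw [windowFunctional_apply, windowSum, Finset.sum_range_succ']
  simp

/-- Prefixes of equal length differ in some coordinate of a token `s`, which the window slot `t - s`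
reads. Prefixes of different lengths are separated by a bias `1` in every slot, which counts the
tokens. -/
theorem range_windowFunctional_separates (z z' : Prefixes N K) (h : z ≠ z') :
    ∃ l ∈ LinearMap.range (windowFunctional (N := N) (K := K)), l z ≠ l z' := by
  obtain ⟨t, p⟩ := z
  obtain ⟨t', p'⟩ := z'
  by_cases ht : t = t'
  · subst ht
    obtain ⟨s, hs⟩ : ∃ s, p s ≠ p' s := by
      by_contra! hp
      exact h (by rw [funext hp])
    obtain ⟨k, hk⟩ : ∃ k, (p s : EuclideanSpace ℝ (Fin n)) k ≠ (p' s : EuclideanSpace ℝ _) k := by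
      by_contra! hp
      exact hs (Subtype.ext (PiLp.ext hp))
    have hst : (s : Fin N).val ≤ t.val := s.2
    have key : ∀ q : {s : Fin N // s ≤ t} → K,
        windowFunctional (N := N) (K := K)
          (fun j => if j = t - s then (Pi.single k 1, 0) else 0) ⟨t, q⟩
          = (q s : EuclideanSpace ℝ (Fin n)) k := by
      intro q
      rw [windowFunctional_apply, windowSum, Finset.sum_eq_single (t.val - (s : Fin N).val)]
      · have : t.val + 1 - (t.val - (s : Fin N).val) = (s : Fin N).val + 1 := by omega
        have hle : (s : Fin N) ≤ t := s.2
        simp [this, padTokens_succ, Prefixes.extend, hle]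
      · intro j _ hj
        simp [hj]
      · intro hj
        exact absurd (Finset.mem_range.2 (by simp only; omega)) hj
    exact ⟨_, ⟨_, rfl⟩, by rw [key, key]; exact hk⟩
  · refine ⟨windowFunctional fun _ => (0, 1), ⟨_, rfl⟩, ?_⟩
    rw [windowFunctional_apply, windowFunctional_apply]
    simpa [windowSum, Fin.ext_iff] using ht

/-- Past-dependent scalar functions are uniform limits of linear combinations of neurons applied
to window sums. -/
theorem exists_sum_windowSum_approx (σ : C(ℝ, ℝ))
    (hσ : ¬ ∃ p : Polynomial ℝ, ∀ z, σ z = p.eval z) (hK : IsCompact K)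
    (h : Fin N → (Fin N → EuclideanSpace ℝ (Fin n)) → ℝ) (hc : ∀ t, Continuous (h t))
    (hpast : ∀ t x x', (∀ s ≤ t, x s = x' s) → h t x = h t x') {ε : ℝ} (hε : 0 < ε) :
    ∃ l : List ((ℕ → (Fin n → ℝ) × ℝ) × ℝ), ∀ x : Fin N → EuclideanSpace ℝ (Fin n),
      (∀ t, x t ∈ K) → ∀ t : Fin N,
        |h t x - (l.map fun p => p.2 * σ (windowSum p.1 (padTokens x) (t + 1))).sum| < ε := by
  have : CompactSpace K := isCompact_iff_compactSpace.1 hK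
  let F : C(Prefixes N K, ℝ) := ⟨fun z => h z.1 z.extend, Prefixes.continuous_of_fst hc⟩
  have htop := topologicalClosure_span_comp_eq_top σ hσ
    (LinearMap.range (windowFunctional (N := N) (K := K)))
    one_mem_range_windowFunctional range_windowFunctional_separates
  have hF : F ∈ (Submodule.span ℝ {G : C(Prefixes N K, ℝ) |
      ∃ l ∈ LinearMap.range (windowFunctional (N := N) (K := K)),
        G = σ.comp l}).topologicalClosure := htop ▸ trivial
  obtain ⟨G, hG, hFG⟩ := Metric.mem_closure_iff.1 hF ε hε
  -- Elements of the span are unfolded into explicit lists, from which the cells are built.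
  obtain ⟨l, hl⟩ : ∃ l : List ((ℕ → (Fin n → ℝ) × ℝ) × ℝ), ∀ z : Prefixes N K,
      G z = (l.map fun p => p.2 * σ (windowFunctional p.1 z)).sum := by
    clear hFG
    induction hG using Submodule.span_induction with
    | mem G hG =>
      obtain ⟨_, ⟨W, rfl⟩, rfl⟩ := hG
      exact ⟨[(W, 1)], fun z => by simp⟩
    | zero => exact ⟨[], fun z => by simp⟩
    | add G G' _ _ ih ih' =>
      obtain ⟨l, hl⟩ := ih
      obtain ⟨l', hl'⟩ := ih'
      exact ⟨l ++ l', fun z => by simp [hl, hl']⟩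
    | smul c G _ ih =>
      obtain ⟨l, hl⟩ := ih
      refine ⟨l.map fun p => (p.1, c * p.2), fun z => ?_⟩
      simp [hl, ← List.sum_map_mul_left, Function.comp_def, mul_assoc]
  refine ⟨l, fun x hx t => ?_⟩
  let z : Prefixes N K := ⟨t, fun s => ⟨x s, hx s⟩⟩
  have hz : ∀ s ≤ t, x s = z.extend s := fun s hs => by simp [Prefixes.extend, z, hs]
  have hw : ∀ W, windowSum W (padTokens x) (t + 1) = windowFunctional W z := by
    intro W
    refine windowSum_congr W fun s hs hst => ?_
    obtain ⟨s, rfl⟩ := Nat.exists_eq_succ_of_ne_zero hs.ne'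
    have hsN : s < N := by have := t.isLt; omega
    have := hz ⟨s, hsN⟩ (by rw [Fin.le_def]; simp only; omega)
    simp [padTokens, hsN, this]
  simp only [hw]
  rw [hpast t x z.extend hz, ← hl z, ← Real.dist_eq]
  exact (ContinuousMap.dist_apply_le_dist (f := F) (g := G) z).trans_lt hFG

end Prefixes

/-! ### Vector-valued outputs and the final estimate. -/

theorem IsPastDependent.eq_of_forall_le {N : ℕ} {X Y : Type*} {f : (Fin N → X) → Fin N → Y}
    (hf : IsPastDependent f) {t : Fin N} {x x' : Fin N → X} (h : ∀ s ≤ t, x s = x' s) :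
    f x t = f x' t := by
  obtain ⟨g, hg⟩ := hf
  rw [hg, hg]
  congr 1
  ext s
  exact h s s.2

theorem exists_sum_windowSum_approx_euclidean {dx dy N : ℕ}
    {f : (Fin N → EuclideanSpace ℝ (Fin dx)) → Fin N → EuclideanSpace ℝ (Fin dy)}
    (hf : Continuous f) (hpast : IsPastDependent f) (σ : C(ℝ, ℝ))
    (hσ : ¬ ∃ p : Polynomial ℝ, ∀ z, σ z = p.eval z) {K : Set (EuclideanSpace ℝ (Fin dx))}
    (hK : IsCompact K) {ε : ℝ} (hε : 0 < ε) :
    ∃ l : List ((ℕ → (Fin dx → ℝ) × ℝ) × (Fin dy → ℝ)), l ≠ [] ∧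
      ∀ x : Fin N → EuclideanSpace ℝ (Fin dx), (∀ t, x t ∈ K) → ∀ t : Fin N,
        ‖f x t - WithLp.toLp 2 fun k =>
          (l.map fun p => p.2 k * σ (windowSum p.1 (padTokens x) (t + 1))).sum‖ < ε := by
  have hε' : 0 < ε / (dy + 1) := by positivity
  have hc : ∀ k t, Continuous fun x => f x t k := fun k t =>
    (EuclideanSpace.proj (𝕜 := ℝ) k).continuous.comp ((continuous_apply t).comp hf)
  choose l hl using fun k : Fin dy =>
    exists_sum_windowSum_approx σ hσ hK (fun t x => f x t k) (hc k)
      (fun t x x' h => by rw [hpast.eq_of_forall_le h]) hε'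
  -- The zero term keeps the list nonempty even if `dy = 0`; a single term already yields at least
  -- two cells.
  refine ⟨(0, 0) :: (List.finRange dy).flatMap fun k => (l k).map fun p =>
    (p.1, Pi.single k p.2), by simp, fun x hx t => ?_⟩
  set v : EuclideanSpace ℝ (Fin dy) := f x t - WithLp.toLp 2 fun k =>
    (((0, 0) :: (List.finRange dy).flatMap fun k => (l k).map fun p =>
      (p.1, Pi.single k p.2)).map fun p : (ℕ → (Fin dx → ℝ) × ℝ) × (Fin dy → ℝ) =>
        p.2 k * σ (windowSum p.1 (padTokens x) (t + 1))).sum with hv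
  have hvk : ∀ k, |v k| ≤ ε / (dy + 1) := by
    intro k
    have hsum : (((0, 0) :: (List.finRange dy).flatMap fun k => (l k).map fun p =>
        (p.1, Pi.single k p.2)).map fun p : (ℕ → (Fin dx → ℝ) × ℝ) × (Fin dy → ℝ) =>
          p.2 k * σ (windowSum p.1 (padTokens x) (t + 1))).sum
        = ((l k).map fun p => p.2 * σ (windowSum p.1 (padTokens x) (t + 1))).sum := by
      rw [List.map_cons, List.sum_cons, List.map_flatMap, List.flatMap_def, List.sum_flatten]
      simp only [List.map_map, Function.comp_def]
      rw [← List.sum_toFinset _ (List.nodup_finRange dy)]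
      rw [Finset.sum_eq_single k]
      · simp
      · intro j _ hj
        simp [Pi.single_eq_of_ne (Ne.symm hj)]
      · simp
    have := (hl k x hx t).le
    simpa only [hv, PiLp.sub_apply, hsum] using this
  calc ‖v‖ ≤ ∑ k, |v k| := by
        rw [EuclideanSpace.norm_eq]
        refine Real.sqrt_le_iff.2 ⟨Finset.sum_nonneg fun _ _ => abs_nonneg _, ?_⟩
        exact Finset.sum_sq_le_sq_sum_of_nonneg fun _ _ => abs_nonneg _
    _ ≤ ∑ _k : Fin dy, ε / (dy + 1) := Finset.sum_le_sum fun k _ => hvk k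
    _ < ε := by
        rw [Finset.sum_const, Finset.card_univ, Fintype.card_fin, nsmul_eq_mul]
        rw [← mul_div_assoc, div_lt_iff₀ (by positivity)]
        nlinarith

theorem theorem1 (dx dy N : ℕ)
    (f : (Fin N → EuclideanSpace ℝ (Fin dx)) → (Fin N → EuclideanSpace ℝ (Fin dy)))
    (hf : Continuous f) (hpast : IsPastDependent f)
    (σ : ℝ → ℝ) (hσ : IsNondegenerate σ)
    (ε : ℝ) (hε : 0 < ε)
    (K : Set (EuclideanSpace ℝ (Fin dx))) (hK : IsCompact K) :
    ∃ n : RNN dx (dx + dy + 3 + additionalWidth σ) dy, n.IsDeep ∧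
      (⨆ (x : Fin N → EuclideanSpace ℝ (Fin dx)) (_ : ∀ t, x t ∈ K) (t : Fin N),
        ‖f x t - n.eval σ x t‖ₑ) < ENNReal.ofReal ε := by
  obtain ⟨hσc, hσp, z₀, hz₀⟩ := hσ
  obtain ⟨l, hlne, hl⟩ := exists_sum_windowSum_approx_euclidean hf hpast ⟨σ, hσc⟩ hσp hK
    (show 0 < ε / 4 by positivity)
  let a := additionalWidth σ
  have e : Option (Component dx dy a) ≃ Fin (dx + dy + 3 + a) :=
    Fintype.equivFinOfCardEq (by simp; omega)
  let P : Matrix (Component dx dy a) (Fin dx) ℝ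
    | .inl (.inl k) => Pi.single k 1
    | _ => 0
  let Q : Matrix (Fin dy) (Component dx dy a) ℝ := fun k => Pi.single (.inl (.inr k)) 1
  let X : (Fin N → EuclideanSpace ℝ (Fin dx)) → ℕ → Component dx dy a → ℝ :=
    fun x t => P *ᵥ padTokens x t
  have hX : Continuous X := continuous_pi fun t =>
    continuous_const.matrix_mulVec ((continuous_apply t).comp continuous_padTokens)
  obtain ⟨n, hn, hnapprox⟩ := MixedCell.exists_rnn_approx e hσc hz₀ N
    (l.flatMap fun p => termCells N p.1 p.2) P Q hX
    (fun x t => by simp only [X, padTokens_succ])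
    (isCompact_univ_pi fun _ : Fin N => hK) (show 0 < ε / 4 by positivity)
  have hideal : ∀ x (t : Fin N), Q *ᵥ MixedCell.run (mixedAct σ z₀ 0)
      (l.flatMap fun p => termCells N p.1 p.2) (X x) (t + 1)
      = fun k => (l.map fun p => p.2 k * σ (windowSum p.1 (padTokens x) (t + 1))).sum := by
    intro x t
    have htok : tokens (X x) = padTokens x := by
      ext t k; simp [tokens, X, P, Matrix.mulVec]
    ext k
    have hQ : ∀ v, (Q *ᵥ v) k = v (.inl (.inr k)) := fun v => by simp [Q, Matrix.mulVec]
    rw [hQ, flatMap_termCells_run (mixedAct_zero_false hz₀) N l _ _ t t.isLt, htok]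
    · simp [X, P, Matrix.mulVec, mixedAct]
    · simp [X, padTokens]
    · intro t; simp [X, P, Matrix.mulVec]
  refine ⟨n, ?_, ?_⟩
  · rw [RNN.IsDeep, hn]
    obtain ⟨p, l, rfl⟩ := List.exists_cons_of_ne_nil hlne
    simp only [List.flatMap_cons, List.length_append, termCells, List.length_cons]
    omega
  -- The two errors of `ε / 4` leave room for the supremum to stay strictly below `ε`.
  · refine lt_of_le_of_lt (b := ENNReal.ofReal (ε / 2)) ?_
      ((ENNReal.ofReal_lt_ofReal_iff hε).2 (by linarith))
    refine iSup_le fun x => iSup_le fun hx => iSup_le fun t => ?_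
    rw [← ofReal_norm]
    refine ENNReal.ofReal_le_ofReal ?_
    have h1 := hl x hx t
    have h2 := hnapprox x (fun t _ => hx t) t
    rw [hideal] at h2
    have := norm_sub_le_norm_sub_add_norm_sub (f x t) (WithLp.toLp 2 fun k =>
      (l.map fun p => p.2 k * σ (windowSum p.1 (padTokens x) (t + 1))).sum) (n.eval σ x t)
    simp only [ContinuousMap.coe_mk] at h1
    linarith
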